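/- **Setting.** A cooperative Markov game consists of agents $1,\dots,N$, a measurable state space $\mathcal S$, a joint action space $\mathcal A=\mathcal A^1\times\dots\times\mathcal A^N$ of non-empty measurable spaces, a measurable transition probability $P(\cdot\mid s,a)$, a measurable team reward $r:\mathcal S\times\mathcal A\to\mathbb R$ and observation functions $o=(o^1,\dots,o^N)$, $o^i:\mathcal S\to\mathcal O^i$; let $\mathcal O=\mathcal O^1\times\dots\times\mathcal O^N$ and let $\gamma\in[0,1)$ be a discount factor. A policy is a measurable transition probability $\pi(\cdot\mid s)$ from $\mathcal S$ to $\mathcal A$. Its values are $V_\pi(s)=\mathbb E_\pi[\sum_{l\ge0}\gamma^l r(s_l,a_l)\mid s_0=s]$ and $Q_\pi(s,a)=\mathbb E_\pi[\sum_{l\ge0}\gamma^l r(s_l,a_l)\mid s_0=s,a_0=a]$, which exist if the series converges absolutely almost surely and its sum is integrable. $V_*(s)$ and $Q_*(s,a)$ are the suprema in $[-\infty,\infty]$ of $V_\pi(s)$ and $Q_\pi(s,a)$ over all policies for which these exist. A group $G$ acts by $L_g:\mathcal S\to\mathcal S$, $K_g^s:\mathcal A\to\mathcal A$ and $H_g^s:\mathcal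 O\to\mathcal O$, such that $G$ acts on $\mathcal S$ by $L_g$, on $\mathcal S\times\mathcal A$ by $(s,a)\mapsto(L_g[s],K_g^s[a])$ and on $\mathcal S\times\mathcal O$ by $(s,y)\mapsto(L_g[s],H_g^s[y])$, the first two measurably for each $g$. The game is $G$-symmetric with invariant reward: for all $g,s,a$ and measurable $B\subseteq\mathcal S$, $$P(L_g[B]\mid L_g[s],K_g^s[a])=P(B\mid s,a),\quad r(L_g[s],K_g^s[a])=r(s,a),\quad o(L_g[s])=H_g^s[o(s)].$$ A policy $\pi$ is $G$-invariant if $\pi(K_g^s[B]\mid L_g[s])=\pi(B\mid s)$ for all $g,s$ and measurable $B\subseteq\mathcal A$. (For discrete spaces, in both conditions, it is enough to take for $B$ a single point.) **Theorem 1.** In such a game: (i) $V_*(s)=V_*(L_g[s])$ and $Q_*(s,a)=Q_*(L_g[s],K_g^s[a])$ for all $g,s,a$. (ii) Let $r$ be bounded. If $\mathcal A$ is finite (with measurable points), there is a $G$-invariant policy $\pi$ with $V_\pi=V_*$ and $Q_\pi=Q_*$. For arbitrary $\mathcal A$, if each $Q_*(s,\cdot)$ has at most one maximizer, every policy $\pi$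 with $V_\pi=V_*$ and $Q_\pi=Q_*$ is $G$-invariant. (iii) If $\pi$ is $G$-invariant, then $V_\pi(s)$ exists if and only if $V_\pi(L_g[s])$ does, $Q_\pi(s,a)$ exists if and only if $Q_\pi(L_g[s],K_g^s[a])$ does, and $V_\pi(s)=V_\pi(L_g[s])$, $Q_\pi(s,a)=Q_\pi(L_g[s],K_g^s[a])$, for all $g,s,a$. (iv) Let $(\pi_\theta)_{\theta\in\mathbb R^d}$ be policies such that, for every $\theta$, $\pi_\theta$ is $G$-invariant. If $\theta\mapsto\pi_\theta(a\mid s)$ is differentiable at $\theta$, then so is $\theta\mapsto\pi_\theta(K_g^s[a]\mid L_g[s])$, and $$\nabla_\theta\pi_\theta(a\mid s)=\nabla_\theta\pi_\theta(K_g^s[a]\mid L_g[s]).$$ Here $\pi_\theta(a\mid s)$ is the probability of the joint action $a$. The same holds if it is the value at $a$ of a density of $\pi_\theta(\cdot\mid s)$ with respect to a fixed measure on $\mathcal A$, when $G$-invariance is understood as $\pi_\theta(K_g^s[a]\mid L_g[s])=\pi_\theta(a\mid s)$ for all $g,s,a$ and $\theta$. -/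

import Mathlib

open MeasureTheory ProbabilityTheory Finset
open scoped ENNReal

noncomputable section

/-- A cooperative Markov game with agents `Fin N`, measurable state space `S`, joint action space
`∀ i, A i` (product σ-algebra) and local observation spaces `O i`. The transition function is a
Markov kernel, so finite, countable and continuous spaces are all covered. -/
structure MarkovGame (N : ℕ) (S : Type*) [MeasurableSpace S]
    (A : Fin N → Type*) [∀ i, MeasurableSpace (A i)] (O : Fin N → Type*) where
  /-- transition function -/
  P : Kernel (S × (∀ i, A i)) S
  markov : IsMarkovKernel P
  /-- team reward -/
  r : S → (∀ i, A i) → ℝ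
  measurable_r : Measurable fun x : S × (∀ i, A i) => r x.1 x.2
  /-- observation functions -/
  o : ∀ i, S → O i

/-- State-based joint policies: each state is sent to a probability distribution over the joint
action space. -/
structure Policy {N : ℕ} (S : Type*) [MeasurableSpace S]
    (A : Fin N → Type*) [∀ i, MeasurableSpace (A i)] where
  kernel : Kernel S (∀ i, A i)
  markov : IsMarkovKernel kernel

attribute [instance] MarkovGame.markov Policy.markov

/-- Group actions of `G` on a Markov game: `L` acts on the states; the transformation `K` of joint
actions and `H` of joint observations may depend on the state, and the transformation `I` of
rewards on the state and the joint action. The laws say that `G` acts on states, on state-action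
pairs, on state-action-reward triples and on state-observation pairs. -/
structure GameAction (G : Type*) [Group G] {N : ℕ} (S : Type*) [MeasurableSpace S]
    (A : Fin N → Type*) [∀ i, MeasurableSpace (A i)] (O : Fin N → Type*) where
  L : G → S → S
  K : G → S → (∀ i, A i) → ∀ i, A i
  I : G → S → (∀ i, A i) → ℝ → ℝ
  H : G → S → (∀ i, O i) → ∀ i, O i
  L_one : ∀ s, L 1 s = s
  L_mul : ∀ g h s, L (g * h) s = L g (L h s)
  K_one : ∀ s a, K 1 s a = a
  K_mul : ∀ g h s a, K (g * h) s a = K g (L h s) (K h s a)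
  I_one : ∀ s a x, I 1 s a x = x
  I_mul : ∀ g h s a x, I (g * h) s a x = I g (L h s) (K h s a) (I h s a x)
  H_one : ∀ s y, H 1 s y = y
  H_mul : ∀ g h s y, H (g * h) s y = H g (L h s) (H h s y)
  measurable_L : ∀ g, Measurable (L g)
  measurable_K : ∀ g, Measurable fun x : S × (∀ i, A i) => K g x.1 x.2

section Definitions

variable {G : Type*} [Group G] {N : ℕ} {S : Type*} [MeasurableSpace S]
  {A : Fin N → Type*} [∀ i, MeasurableSpace (A i)] {O : Fin N → Type*}

/-- The game is `G`-symmetric: transition, reward and observation functions are equivariant.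
For a state space with measurable points, the transition clause at `B = {s'}` reads
`P(L_g[s'] | L_g[s], K_g^s[a]) = P(s' | s, a)`. -/
structure MarkovGame.IsSymmetric (M : MarkovGame N S A O) (T : GameAction G S A O) : Prop where
  transition : ∀ g s a (B : Set S), MeasurableSet B →
    M.P (T.L g s, T.K g s a) (T.L g '' B) = M.P (s, a) B
  reward : ∀ g s a, M.r (T.L g s) (T.K g s a) = T.I g s a (M.r s a)
  observation : ∀ g s, (fun i => M.o i (T.L g s)) = T.H g s (fun i => M.o i s)

/-- The policy is `G`-invariant: `π(K_g^s[B] | L_g[s]) = π(B | s)` for all events `B`. -/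
def Policy.IsInvariant (π : Policy S A) (T : GameAction G S A O) : Prop :=
  ∀ g s (B : Set (∀ i, A i)), MeasurableSet B →
    π.kernel (T.L g s) (T.K g s '' B) = π.kernel s B

namespace MarkovGame

variable (M : MarkovGame N S A O) (γ : ℝ) (π : Policy S A)

/-- One step of the state-action process under `π`: draw `s'` from `P(· | s, a)`, then `a'` from
`π(· | s')`. -/
def step : Kernel (S × (∀ i, A i)) (S × (∀ i, A i)) :=
  (Kernel.id ×ₖ π.kernel) ∘ₖ M.P

instance : IsMarkovKernel (M.step π) := by unfold step; infer_instance

/-- The step kernel as a function of the history up to time `n`. -/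
def stepHist (n : ℕ) : Kernel (∀ _ : Iic n, S × (∀ i, A i)) (S × (∀ i, A i)) :=
  (M.step π).comap (fun h => h ⟨n, by simp⟩) (by fun_prop)

instance (n : ℕ) : IsMarkovKernel (M.stepHist π n) := by unfold stepHist; infer_instance

/-- The law of the trajectory `(s_0, a_0), (s_1, a_1), …` under `π` when `(s_0, a_0)` has law
`ρ`. -/
def pathLaw (ρ : Measure (S × (∀ i, A i))) : Measure (ℕ → S × (∀ i, A i)) :=
  Kernel.trajMeasure (X := fun _ => S × (∀ i, A i)) ρ (M.stepHist π)

/-- The law of the trajectory under `π` given `s_0 = s`. -/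
def lawV (s : S) : Measure (ℕ → S × (∀ i, A i)) :=
  M.pathLaw π ((π.kernel s).map fun a => (s, a))

/-- The law of the trajectory under `π` given `s_0 = s`, `a_0 = a`. -/
def lawQ (s : S) (a : ∀ i, A i) : Measure (ℕ → S × (∀ i, A i)) :=
  M.pathLaw π (Measure.dirac (s, a))

/-- The discounted return `∑ γ^l r(s_l, a_l)` of a trajectory. -/
def ret (ω : ℕ → S × (∀ i, A i)) : ℝ :=
  ∑' l, γ ^ l * M.r (ω l).1 (ω l).2

/-- The expected return under a law of trajectories exists: the series converges almost surely and
its sum is integrable. -/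
def HasExpectedRet (μ : Measure (ℕ → S × (∀ i, A i))) : Prop :=
  (∀ᵐ ω ∂μ, Summable fun l => γ ^ l * M.r (ω l).1 (ω l).2) ∧ Integrable (M.ret γ) μ

/-- The value `V_π(s)`. -/
def V (s : S) : ℝ := ∫ ω, M.ret γ ω ∂(M.lawV π s)

/-- The action-value `Q_π(s, a)`. -/
def Q (s : S) (a : ∀ i, A i) : ℝ := ∫ ω, M.ret γ ω ∂(M.lawQ π s a)

/-- The optimal value `V_*(s)`: the supremum, in the extended reals, of the values at `s` of all
policies that have a value there. -/
def Vstar (s : S) : EReal :=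
  ⨆ (π : Policy S A) (_ : M.HasExpectedRet γ (M.lawV π s)), (M.V γ π s : EReal)

/-- The optimal action-value `Q_*(s, a)`. -/
def Qstar (s : S) (a : ∀ i, A i) : EReal :=
  ⨆ (π : Policy S A) (_ : M.HasExpectedRet γ (M.lawQ π s a)), (M.Q γ π s a : EReal)

/-- `π` attains the optimal values: its values exist and equal `V_*` and `Q_*`. -/
def IsOptimal : Prop :=
  (∀ s, M.HasExpectedRet γ (M.lawV π s) ∧ (M.V γ π s : EReal) = M.Vstar γ s) ∧
  (∀ s a, M.HasExpectedRet γ (M.lawQ π s a) ∧ (M.Q γ π s a : EReal) = M.Qstar γ s a)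

end MarkovGame

/-- `p a` is the likelihood of the joint action `a` under `μ` with respect to the reference
measure `ν` (a density, or the probability of `a` if `ν` is the counting measure). -/
def IsLikelihood (ν μ : Measure (∀ i, A i)) (p : (∀ i, A i) → ℝ) : Prop :=
  Measurable p ∧ (∀ a, 0 ≤ p a) ∧ μ = ν.withDensity fun a => ENNReal.ofReal (p a)

end Definitions

end

/-!
A group element acts on state-action pairs by a measurable bijection. If a policy `π'` plays at
`L_g[s]` the image under `K_g^s` of what `π` plays at `s` (`GameAction.Carries`), then by the
symmetry of the transition function this bijection intertwines the one-step kernels of the two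
state-action processes, hence maps the law of trajectories under `π` to that under `π'`
(`trajMeasure_map`). The return of a trajectory is invariant, so `π'` has at the image point the
value that `π` has at the original one, and the one exists iff the other does. An invariant policy
carries itself along the action, which gives the invariance of its values. Any policy can be
transported (`GameAction.transport`), which gives the invariance of the optimal values.

For bounded rewards, `Q_π` is the discounted sum of the expected rewards, satisfies the Bellman
equation and obeys a comparison principle (`MarkovGame.le_of_bellman`). With finitely many joint
actions, value iteration yields a solution `q` of the Bellman optimality equation. By comparison `q`
dominates every `Q_π` and equals `Q_π` if `π` plays maximizers of `q`; so `q = Q_*`, which is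
invariant. The policy choosing uniformly among the maximizers is then optimal and invariant,
because `K_g^s` permutes the maximizers at `s` onto those at `L_g[s]`.

For arbitrary action spaces, an optimal `π` satisfies `Q_π(s, a) ≤ V_π(s)`, since otherwise it could
be improved (`MarkovGame.exists_improvement`). As `V_π(s)` is the mean of `Q_π(s, ·)` under
`π(· | s)`, this distribution is carried by maximizers of `Q_*(s, ·)`. If there is at most one, it is
the point mass there, and maximizers correspond under the group action.

The statements on gradients hold because the two functions of the parameter coincide.
-/

/-! ### Laws of trajectories -/

/-- A finite measure on sequences is determined by its marginals on initial segments. -/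
theorem measure_ext_of_map_frestrictLe {X : ℕ → Type*} [∀ n, MeasurableSpace (X n)]
    {μ ν : Measure (∀ n, X n)} [IsFiniteMeasure μ] [IsFiniteMeasure ν]
    (h : ∀ n, μ.map (Preorder.frestrictLe n) = ν.map (Preorder.frestrictLe n)) : μ = ν := by
  refine IsProjectiveLimit.unique (P := fun I => ν.map I.restrict) ?_ (fun I => rfl)
  intro I
  have hI : I ⊆ Iic (I.sup id) := I.subset_Iic_sup_id
  change μ.map I.restrict = ν.map I.restrict
  rw [← restrict₂_comp_restrict hI, ← Measure.map_map (by fun_prop) (by fun_prop),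
    ← Measure.map_map (by fun_prop) (by fun_prop)]
  exact congrArg _ (h _)

/-- If `κ'` at an image point `f x` is the image of `κ` at `x`, then composing `μ` with the kernel
and pushing forward commute. -/
theorem map_compProd_eq_of_intertwine {α β α' β' : Type*} [MeasurableSpace α] [MeasurableSpace β]
    [MeasurableSpace α'] [MeasurableSpace β'] (μ : Measure α) [SFinite μ] (κ : Kernel α β)
    [IsSFiniteKernel κ] (κ' : Kernel α' β') [IsSFiniteKernel κ'] {f : α → α'} {g : β → β'}
    (hf : Measurable f) (hg : Measurable g) (h : ∀ x, κ' (f x) = (κ x).map g) :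
    (μ.map f) ⊗ₘ κ' = (μ ⊗ₘ κ).map (Prod.map f g) := by
  ext s hs
  have hs' : MeasurableSet (Prod.map f g ⁻¹' s) := hs.preimage (hf.prodMap hg)
  rw [Measure.compProd_apply hs, Measure.map_apply (hf.prodMap hg) hs,
    Measure.compProd_apply hs', lintegral_map (Kernel.measurable_kernel_prodMk_left hs) hf]
  refine lintegral_congr fun x => ?_
  rw [h, Measure.map_apply hg (hs.preimage measurable_prodMk_left)]
  rfl

/-- The history up to time `n + 1` obtained by appending a point to a history up to time `n`. -/
def appendHist {X : Type*} (n : ℕ) (p : (∀ _ : Iic n, X) × X) : ∀ _ : Iic (n + 1), X :=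
  fun i => if h : (i : ℕ) ≤ n then p.1 ⟨i, mem_Iic.2 h⟩ else p.2

theorem appendHist_frestrictLe {X : Type*} (n : ℕ) (ω : ℕ → X) :
    appendHist n (Preorder.frestrictLe (π := fun _ => X) n ω, ω (n + 1)) =
      Preorder.frestrictLe (π := fun _ => X) (n + 1) ω := by
  funext i
  unfold appendHist
  split_ifs with h
  · rfl
  · have h1 : (i : ℕ) ≤ n + 1 := mem_Iic.1 i.2
    have h2 : (i : ℕ) = n + 1 := by omega
    simp [← h2]

section Traj

variable {X Y : Type*} [MeasurableSpace X] [MeasurableSpace Y]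

theorem map_zero_trajMeasure (ρ : Measure X) [IsProbabilityMeasure ρ]
    (κ : ∀ n : ℕ, Kernel (∀ _ : Iic n, X) X) [∀ n, IsMarkovKernel (κ n)] :
    (Kernel.trajMeasure (X := fun _ => X) ρ κ).map (fun ω => ω 0) = ρ := by
  have h0 : (fun ω : ℕ → X => ω 0) =
      (fun h : (∀ _ : Iic 0, X) => h ⟨0, by simp⟩) ∘ Preorder.frestrictLe (π := fun _ => X) 0 := rfl
  rw [h0, ← Measure.map_map (by fun_prop) (by fun_prop), Kernel.trajMeasure,
    Measure.map_comp _ _ (by fun_prop), Kernel.traj_map_frestrictLe, Kernel.partialTraj_self,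
    Measure.id_comp, Measure.map_map (by fun_prop) (by fun_prop)]
  exact Measure.map_id

theorem map_frestrictLe_succ_trajMeasure (ρ : Measure X) [IsProbabilityMeasure ρ]
    (κ : ∀ n : ℕ, Kernel (∀ _ : Iic n, X) X) [∀ n, IsMarkovKernel (κ n)] (n : ℕ) :
    (Kernel.trajMeasure (X := fun _ => X) ρ κ).map (fun ω => (Preorder.frestrictLe n ω, ω (n + 1)))
      = (Kernel.trajMeasure (X := fun _ => X) ρ κ).map (Preorder.frestrictLe n) ⊗ₘ κ n :=
  Kernel.map_frestrictLe_trajMeasure_compProd_eq_map_trajMeasure.symm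

theorem measurable_appendHist (n : ℕ) : Measurable (appendHist (X := X) n) := by
  refine measurable_pi_lambda _ fun i => ?_
  unfold appendHist
  split_ifs <;> fun_prop

/-- A map intertwining the transition kernels of two processes maps the law of trajectories of the
one to that of the other. -/
theorem trajMeasure_map (ρ : Measure X) [IsProbabilityMeasure ρ]
    (κ : ∀ n : ℕ, Kernel (∀ _ : Iic n, X) X) [∀ n, IsMarkovKernel (κ n)]
    (κ' : ∀ n : ℕ, Kernel (∀ _ : Iic n, Y) Y) [∀ n, IsMarkovKernel (κ' n)]
    {e : X → Y} (he : Measurable e)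
    (h : ∀ n x, κ' n (fun i => e (x i)) = (κ n x).map e) :
    Kernel.trajMeasure (X := fun _ => Y) (ρ.map e) κ' =
      (Kernel.trajMeasure (X := fun _ => X) ρ κ).map (fun ω n => e (ω n)) := by
  have : IsProbabilityMeasure (ρ.map e) := Measure.isProbabilityMeasure_map he.aemeasurable
  have hE : Measurable (fun (ω : ℕ → X) n => e (ω n)) := by fun_prop
  have hE' (n : ℕ) : Measurable (fun (x : ∀ _ : Iic n, X) i => e (x i)) := by fun_prop
  have := Measure.isProbabilityMeasure_map
    (μ := Kernel.trajMeasure (X := fun _ => X) ρ κ) hE.aemeasurable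
  refine measure_ext_of_map_frestrictLe fun n => ?_
  rw [Measure.map_map (by fun_prop) hE]
  induction n with
  | zero =>
    have key (Z : Type _) [MeasurableSpace Z] (m : Measure (ℕ → Z)) :
        m.map (Preorder.frestrictLe (π := fun _ => Z) 0) =
          (m.map (fun ω => ω 0)).map (fun z _ => z) := by
      rw [Measure.map_map (by fun_prop) (by fun_prop)]
      congr 1
      funext ω i
      have h1 : (i : ℕ) = 0 := Nat.le_zero.1 (mem_Iic.1 i.2)
      simp [h1]
    rw [key, map_zero_trajMeasure, ← Measure.map_map (by fun_prop) hE, key,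
      Measure.map_map (by fun_prop) hE]
    congr 1
    conv_lhs => rw [← map_zero_trajMeasure ρ κ]
    rw [Measure.map_map he (by fun_prop)]
    rfl
  | succ n ih =>
    have hY : Preorder.frestrictLe (π := fun _ => Y) (n + 1) =
        appendHist n ∘ fun ω => (Preorder.frestrictLe (π := fun _ => Y) n ω, ω (n + 1)) :=
      funext fun ω => (appendHist_frestrictLe n ω).symm
    rw [hY, ← Measure.map_map (measurable_appendHist n) (by fun_prop),
      map_frestrictLe_succ_trajMeasure, ih, Function.comp_assoc,
      ← Measure.map_map (measurable_appendHist n) (by fun_prop)]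
    congr 1
    have h1 : (Preorder.frestrictLe (π := fun _ => Y) n ∘ fun (ω : ℕ → X) n => e (ω n)) =
        (fun (x : ∀ _ : Iic n, X) i => e (x i)) ∘ Preorder.frestrictLe (π := fun _ => X) n := rfl
    rw [h1, ← Measure.map_map (hE' n) (by fun_prop),
      map_compProd_eq_of_intertwine _ (κ n) (κ' n) (hE' n) he (h n),
      ← map_frestrictLe_succ_trajMeasure,
      Measure.map_map ((hE' n).prodMap he) (by fun_prop)]
    rfl

end Traj

namespace MarkovGame

variable {N : ℕ} {S : Type*} [MeasurableSpace S] {A : Fin N → Type*} [∀ i, MeasurableSpace (A i)]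
  {O : Fin N → Type*} (M : MarkovGame N S A O) (γ : ℝ) (π : Policy S A)

instance (ρ : Measure (S × (∀ i, A i))) [IsProbabilityMeasure ρ] :
    IsProbabilityMeasure (M.pathLaw π ρ) := by
  unfold pathLaw; infer_instance

theorem isProbabilityMeasure_initial (s : S) :
    IsProbabilityMeasure ((π.kernel s).map fun a => (s, a)) :=
  Measure.isProbabilityMeasure_map (by fun_prop)

instance (s : S) : IsProbabilityMeasure (M.lawV π s) := by
  have := isProbabilityMeasure_initial π s
  unfold lawV; infer_instance

instance (s : S) (a : ∀ i, A i) : IsProbabilityMeasure (M.lawQ π s a) := by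
  unfold lawQ; infer_instance

theorem step_apply (x : S × (∀ i, A i)) : M.step π x = M.P x ⊗ₘ π.kernel := by
  rw [step, Kernel.comp_apply, Measure.compProd_eq_comp_prod]

/-- The state-action pair at time `n + 1` is drawn from the step kernel at the pair at time `n`. -/
theorem map_succ_pathLaw (ρ : Measure (S × (∀ i, A i))) [IsProbabilityMeasure ρ] (n : ℕ) :
    (M.pathLaw π ρ).map (fun ω => ω (n + 1)) =
      M.step π ∘ₘ (M.pathLaw π ρ).map (fun ω => ω n) := by
  have h1 := congrArg Measure.snd (map_frestrictLe_succ_trajMeasure ρ (M.stepHist π) n)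
  rw [Measure.snd_map_prodMk (by fun_prop), Measure.snd_compProd] at h1
  refine h1.trans ?_
  have h2 : (M.pathLaw π ρ).map (fun ω => ω n) =
      ((M.pathLaw π ρ).map (Preorder.frestrictLe n)).map (fun h => h ⟨n, by simp⟩) := by
    rw [Measure.map_map (by fun_prop) (by fun_prop)]
    rfl
  have h3 (m : Measure (∀ _ : Iic n, S × (∀ i, A i))) :
      M.step π ∘ₘ m.map (fun h => h ⟨n, by simp⟩) = M.stepHist π n ∘ₘ m := by
    rw [← Measure.deterministic_comp_eq_map (by fun_prop), Measure.comp_assoc,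
      Kernel.comp_deterministic_eq_comap]
    rfl
  rw [h2, h3]
  rfl

end MarkovGame

/-! ### Transport of policies along the group action -/

namespace GameAction

variable {G : Type*} [Group G] {N : ℕ} {S : Type*} [MeasurableSpace S]
  {A : Fin N → Type*} [∀ i, MeasurableSpace (A i)] {O : Fin N → Type*} (T : GameAction G S A O)

theorem L_inv_L (g : G) (s : S) : T.L g⁻¹ (T.L g s) = s := by
  rw [← T.L_mul, inv_mul_cancel, T.L_one]

theorem L_L_inv (g : G) (s : S) : T.L g (T.L g⁻¹ s) = s := by
  rw [← T.L_mul, mul_inv_cancel, T.L_one]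

theorem K_inv_K (g : G) (s : S) (a : ∀ i, A i) : T.K g⁻¹ (T.L g s) (T.K g s a) = a := by
  rw [← T.K_mul, inv_mul_cancel, T.K_one]

theorem K_K_inv (g : G) (s : S) (a : ∀ i, A i) : T.K g s (T.K g⁻¹ (T.L g s) a) = a := by
  have := T.K_mul g g⁻¹ (T.L g s) a
  rwa [mul_inv_cancel, T.K_one, L_inv_L, eq_comm] at this

/-- The action of `g` on states, as a measurable equivalence. -/
def stateEquiv (g : G) : S ≃ᵐ S where
  toFun := T.L g
  invFun := T.L g⁻¹
  left_inv := T.L_inv_L g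
  right_inv := T.L_L_inv g
  measurable_toFun := T.measurable_L g
  measurable_invFun := T.measurable_L g⁻¹

/-- The action of `g` on the joint actions available at `s`, as a measurable equivalence. -/
def actionEquiv (g : G) (s : S) : (∀ i, A i) ≃ᵐ (∀ i, A i) where
  toFun := T.K g s
  invFun := T.K g⁻¹ (T.L g s)
  left_inv := T.K_inv_K g s
  right_inv := T.K_K_inv g s
  measurable_toFun := (T.measurable_K g).comp measurable_prodMk_left
  measurable_invFun := (T.measurable_K g⁻¹).comp measurable_prodMk_left

/-- The action of `g` on state-action pairs, as a measurable equivalence. -/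
def pairEquiv (g : G) : S × (∀ i, A i) ≃ᵐ S × (∀ i, A i) where
  toFun x := (T.L g x.1, T.K g x.1 x.2)
  invFun x := (T.L g⁻¹ x.1, T.K g⁻¹ x.1 x.2)
  left_inv x := by simp [L_inv_L, K_inv_K]
  right_inv x := by
    have := T.K_K_inv g (T.L g⁻¹ x.1) x.2
    rw [L_L_inv] at this
    simp [L_L_inv, this]
  measurable_toFun := ((T.measurable_L g).comp measurable_fst).prodMk (T.measurable_K g)
  measurable_invFun := ((T.measurable_L g⁻¹).comp measurable_fst).prodMk (T.measurable_K g⁻¹)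

/-- The action of `g` on trajectories of state-action pairs, as a measurable equivalence. -/
def trajEquiv (g : G) : (ℕ → S × (∀ i, A i)) ≃ᵐ (ℕ → S × (∀ i, A i)) :=
  MeasurableEquiv.piCongrRight fun _ => T.pairEquiv g

theorem measurable_K_right (g : G) (s : S) : Measurable (T.K g s) := (T.actionEquiv g s).measurable

/-- `π'` plays at `L_g[s]` the image under `K_g^s` of what `π` plays at `s`. -/
def Carries (g : G) (π π' : Policy S A) : Prop :=
  ∀ s, π'.kernel (T.L g s) = (π.kernel s).map (T.K g s)

/-- The image of a policy under a group element. -/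
noncomputable def transport (g : G) (π : Policy S A) : Policy S A where
  kernel := ((Kernel.id ×ₖ π.kernel).map fun x => T.K g x.1 x.2).comap (T.L g⁻¹)
    (T.measurable_L g⁻¹)
  markov := by
    have := Kernel.IsMarkovKernel.map (Kernel.id ×ₖ π.kernel) (T.measurable_K g)
    infer_instance

theorem carries_transport (g : G) (π : Policy S A) : T.Carries g π (T.transport g π) := by
  intro s
  change (((Kernel.id ×ₖ π.kernel).map fun x => T.K g x.1 x.2).comap (T.L g⁻¹) (T.measurable_L g⁻¹)) (T.L g s)
    = _
  rw [Kernel.comap_apply, L_inv_L, Kernel.map_apply _ (T.measurable_K g), Kernel.prod_apply,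
    Kernel.id_apply, Measure.dirac_prod, Measure.map_map (T.measurable_K g) (by fun_prop)]
  rfl

end GameAction

section Transport

variable {G : Type*} [Group G] {N : ℕ} {S : Type*} [MeasurableSpace S]
  {A : Fin N → Type*} [∀ i, MeasurableSpace (A i)] {O : Fin N → Type*} {T : GameAction G S A O}

theorem Policy.IsInvariant.carries {π : Policy S A} (h : π.IsInvariant T) (g : G) :
    T.Carries g π π := by
  intro s
  ext B hB
  have h1 := h g s (T.K g s ⁻¹' B) (hB.preimage (T.measurable_K_right g s))
  have hsurj : Function.Surjective (T.K g s) := (T.actionEquiv g s).surjective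
  rw [Set.image_preimage_eq _ hsurj] at h1
  rw [h1, Measure.map_apply (T.measurable_K_right g s) hB]

/-- For an invariant policy the invariance extends to sets that need not be measurable. -/
theorem Policy.IsInvariant.kernel_image {π : Policy S A} (h : π.IsInvariant T) (g : G) (s : S)
    (B : Set (∀ i, A i)) : π.kernel (T.L g s) (T.K g s '' B) = π.kernel s B := by
  rw [h.carries g s]
  refine ((T.actionEquiv g s).map_apply _).trans ?_
  exact congrArg _ (Set.preimage_image_eq _ (T.actionEquiv g s).injective)

namespace MarkovGame

variable {M : MarkovGame N S A O}

theorem IsSymmetric.map_P (hM : M.IsSymmetric T) (g : G) (x : S × (∀ i, A i)) :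
    M.P (T.pairEquiv g x) = (M.P x).map (T.L g) := by
  ext B hB
  have h1 := hM.transition g x.1 x.2 (T.L g ⁻¹' B) (hB.preimage (T.measurable_L g))
  have hsurj : Function.Surjective (T.L g) := (T.stateEquiv g).surjective
  rw [Set.image_preimage_eq _ hsurj] at h1
  rw [Measure.map_apply (T.measurable_L g) hB]
  exact h1

variable {g : G} {π π' : Policy S A}

theorem IsSymmetric.map_step (hM : M.IsSymmetric T) (h : T.Carries g π π')
    (x : S × (∀ i, A i)) : M.step π' (T.pairEquiv g x) = (M.step π x).map (T.pairEquiv g) := by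
  have hm := (T.pairEquiv g).measurable
  ext B hB
  rw [step_apply, step_apply, hM.map_P, Measure.compProd_apply hB, Measure.map_apply hm hB,
    Measure.compProd_apply (hB.preimage hm),
    lintegral_map (Kernel.measurable_kernel_prodMk_left hB) (T.measurable_L g)]
  refine lintegral_congr fun s => ?_
  rw [h s, Measure.map_apply (T.measurable_K_right g s) (hB.preimage measurable_prodMk_left)]
  rfl

theorem IsSymmetric.map_pathLaw (hM : M.IsSymmetric T) (h : T.Carries g π π')
    (ρ : Measure (S × (∀ i, A i))) [IsProbabilityMeasure ρ] :
    M.pathLaw π' (ρ.map (T.pairEquiv g)) = (M.pathLaw π ρ).map (T.trajEquiv g) :=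
  trajMeasure_map ρ (M.stepHist π) (M.stepHist π') (T.pairEquiv g).measurable
    fun _ _ => hM.map_step h _

theorem IsSymmetric.lawV_eq_map (hM : M.IsSymmetric T) (h : T.Carries g π π') (s : S) :
    M.lawV π' (T.L g s) = (M.lawV π s).map (T.trajEquiv g) := by
  have := isProbabilityMeasure_initial π s
  rw [lawV, lawV, ← hM.map_pathLaw h, h s, Measure.map_map (by fun_prop) (T.measurable_K_right g s),
    Measure.map_map (T.pairEquiv g).measurable (by fun_prop)]
  rfl

theorem IsSymmetric.lawQ_eq_map (hM : M.IsSymmetric T) (h : T.Carries g π π') (s : S)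
    (a : ∀ i, A i) : M.lawQ π' (T.L g s) (T.K g s a) = (M.lawQ π s a).map (T.trajEquiv g) := by
  rw [lawQ, lawQ, ← hM.map_pathLaw h, Measure.map_dirac' (T.pairEquiv g).measurable]
  rfl

theorem IsSymmetric.reward_pairEquiv (hM : M.IsSymmetric T) (hI : ∀ g s a x, T.I g s a x = x)
    (g : G) (x : S × (∀ i, A i)) :
    M.r (T.pairEquiv g x).1 (T.pairEquiv g x).2 = M.r x.1 x.2 :=
  (hM.reward g x.1 x.2).trans (hI _ _ _ _)

theorem IsSymmetric.ret_comp_trajEquiv (hM : M.IsSymmetric T)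
    (hI : ∀ g s a x, T.I g s a x = x) (γ : ℝ) (g : G) :
    M.ret γ ∘ T.trajEquiv g = M.ret γ :=
  funext fun ω => tsum_congr fun l =>
    congrArg (γ ^ l * ·) (hM.reward_pairEquiv hI g (ω l))

theorem IsSymmetric.hasExpectedRet_map (hM : M.IsSymmetric T)
    (hI : ∀ g s a x, T.I g s a x = x) (γ : ℝ) (g : G) (μ : Measure (ℕ → S × (∀ i, A i))) :
    M.HasExpectedRet γ (μ.map (T.trajEquiv g)) ↔ M.HasExpectedRet γ μ := by
  unfold HasExpectedRet
  rw [(T.trajEquiv g).measurableEmbedding.ae_map_iff,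
    (T.trajEquiv g).measurableEmbedding.integrable_map_iff, hM.ret_comp_trajEquiv hI]
  refine and_congr (Filter.eventually_congr (ae_of_all _ fun ω => ?_)) Iff.rfl
  exact summable_congr fun l => congrArg (γ ^ l * ·) (hM.reward_pairEquiv hI g (ω l))

theorem IsSymmetric.integral_ret_map (hM : M.IsSymmetric T)
    (hI : ∀ g s a x, T.I g s a x = x) (γ : ℝ) (g : G) (μ : Measure (ℕ → S × (∀ i, A i))) :
    ∫ ω, M.ret γ ω ∂(μ.map (T.trajEquiv g)) = ∫ ω, M.ret γ ω ∂μ := by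
  rw [(T.trajEquiv g).measurableEmbedding.integral_map]
  exact integral_congr_ae (ae_of_all _ (congrFun (hM.ret_comp_trajEquiv hI γ g)))

theorem IsSymmetric.hasExpectedRet_lawV_iff (hM : M.IsSymmetric T)
    (hI : ∀ g s a x, T.I g s a x = x) (γ : ℝ) (h : T.Carries g π π') (s : S) :
    M.HasExpectedRet γ (M.lawV π' (T.L g s)) ↔ M.HasExpectedRet γ (M.lawV π s) := by
  rw [hM.lawV_eq_map h, hM.hasExpectedRet_map hI]

theorem IsSymmetric.hasExpectedRet_lawQ_iff (hM : M.IsSymmetric T)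
    (hI : ∀ g s a x, T.I g s a x = x) (γ : ℝ) (h : T.Carries g π π') (s : S) (a : ∀ i, A i) :
    M.HasExpectedRet γ (M.lawQ π' (T.L g s) (T.K g s a)) ↔ M.HasExpectedRet γ (M.lawQ π s a) := by
  rw [hM.lawQ_eq_map h, hM.hasExpectedRet_map hI]

theorem IsSymmetric.V_eq (hM : M.IsSymmetric T) (hI : ∀ g s a x, T.I g s a x = x) (γ : ℝ)
    (h : T.Carries g π π') (s : S) : M.V γ π' (T.L g s) = M.V γ π s := by
  rw [V, V, hM.lawV_eq_map h, hM.integral_ret_map hI]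

theorem IsSymmetric.Q_eq (hM : M.IsSymmetric T) (hI : ∀ g s a x, T.I g s a x = x) (γ : ℝ)
    (h : T.Carries g π π') (s : S) (a : ∀ i, A i) :
    M.Q γ π' (T.L g s) (T.K g s a) = M.Q γ π s a := by
  rw [Q, Q, hM.lawQ_eq_map h, hM.integral_ret_map hI]

theorem IsSymmetric.Vstar_le (hM : M.IsSymmetric T) (hI : ∀ g s a x, T.I g s a x = x) (γ : ℝ)
    (g : G) (s : S) : M.Vstar γ s ≤ M.Vstar γ (T.L g s) := by
  refine iSup₂_le fun π hπ => ?_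
  have hc := T.carries_transport g π
  rw [← hM.V_eq hI γ hc]
  exact le_iSup₂_of_le _ ((hM.hasExpectedRet_lawV_iff hI γ hc s).2 hπ) le_rfl

theorem IsSymmetric.Qstar_le (hM : M.IsSymmetric T) (hI : ∀ g s a x, T.I g s a x = x) (γ : ℝ)
    (g : G) (s : S) (a : ∀ i, A i) : M.Qstar γ s a ≤ M.Qstar γ (T.L g s) (T.K g s a) := by
  refine iSup₂_le fun π hπ => ?_
  have hc := T.carries_transport g π
  rw [← hM.Q_eq hI γ hc]
  exact le_iSup₂_of_le _ ((hM.hasExpectedRet_lawQ_iff hI γ hc s a).2 hπ) le_rfl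

theorem IsSymmetric.Vstar_eq (hM : M.IsSymmetric T) (hI : ∀ g s a x, T.I g s a x = x) (γ : ℝ)
    (g : G) (s : S) : M.Vstar γ s = M.Vstar γ (T.L g s) := by
  refine (hM.Vstar_le hI γ g s).antisymm ?_
  simpa only [T.L_inv_L] using hM.Vstar_le hI γ g⁻¹ (T.L g s)

theorem IsSymmetric.Qstar_eq (hM : M.IsSymmetric T) (hI : ∀ g s a x, T.I g s a x = x) (γ : ℝ)
    (g : G) (s : S) (a : ∀ i, A i) : M.Qstar γ s a = M.Qstar γ (T.L g s) (T.K g s a) := by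
  refine (hM.Qstar_le hI γ g s a).antisymm ?_
  simpa only [T.L_inv_L, T.K_inv_K] using hM.Qstar_le hI γ g⁻¹ (T.L g s) (T.K g s a)

end MarkovGame

end Transport

/-! ### Discounted sums and contraction -/

/-- A function that is bounded above and whose nonnegative upper bounds may all be shrunk by the
factor `γ < 1` is nonpositive. -/
theorem nonpos_of_bound_mul {X : Type*} {f : X → ℝ} {γ B : ℝ} (hγ0 : 0 ≤ γ) (hγ1 : γ < 1)
    (hB : ∀ x, f x ≤ B) (h : ∀ c, 0 ≤ c → (∀ x, f x ≤ c) → ∀ x, f x ≤ γ * c) (x : X) :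
    f x ≤ 0 := by
  have hn (n : ℕ) : ∀ y, f y ≤ γ ^ n * |B| := by
    induction n with
    | zero => exact fun y => by simpa using (hB y).trans (le_abs_self B)
    | succ n ih =>
      intro y
      rw [pow_succ', mul_assoc]
      exact h _ (by positivity) ih y
  have ht : Filter.Tendsto (fun n : ℕ => γ ^ n * |B|) Filter.atTop (nhds 0) := by
    simpa using (tendsto_pow_atTop_nhds_zero_of_lt_one hγ0 hγ1).mul_const |B|
  exact ge_of_tendsto' ht fun n => hn n x

section Bounded

variable {X : Type*} [MeasurableSpace X]

theorem integrable_of_measurable_of_abs_le (μ : Measure X) [IsFiniteMeasure μ] {f : X → ℝ} {C : ℝ}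
    (hf : Measurable f) (hC : ∀ x, |f x| ≤ C) : Integrable f μ :=
  Integrable.of_bound hf.aestronglyMeasurable C (ae_of_all _ hC)

theorem abs_integral_le_of_abs_le (μ : Measure X) [IsProbabilityMeasure μ] {f : X → ℝ} {C : ℝ}
    (hC : ∀ x, |f x| ≤ C) : |∫ x, f x ∂μ| ≤ C := by
  simpa using norm_integral_le_of_norm_le_const (μ := μ) (f := f) (C := C) (ae_of_all _ hC)

theorem integral_le_of_forall_le (μ : Measure X) [IsProbabilityMeasure μ] {f : X → ℝ} {c : ℝ}
    (hf : Integrable f μ) (hc : ∀ x, f x ≤ c) : ∫ x, f x ∂μ ≤ c := by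
  simpa using integral_mono hf (integrable_const c) hc

variable {γ C : ℝ}

theorem norm_discount_mul_le (hγ0 : 0 ≤ γ) {f : ℕ → ℝ} (hC : ∀ n, |f n| ≤ C) (n : ℕ) :
    ‖γ ^ n * f n‖ ≤ γ ^ n * C := by
  rw [Real.norm_eq_abs, abs_mul, abs_of_nonneg (pow_nonneg hγ0 n)]
  exact mul_le_mul_of_nonneg_left (hC n) (pow_nonneg hγ0 n)

theorem summable_discount (hγ0 : 0 ≤ γ) (hγ1 : γ < 1) {f : ℕ → ℝ} (hC : ∀ n, |f n| ≤ C) :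
    Summable fun n => γ ^ n * f n :=
  Summable.of_norm_bounded ((summable_geometric_of_lt_one hγ0 hγ1).mul_right C)
    (norm_discount_mul_le hγ0 hC)

theorem abs_tsum_discount_le (hγ0 : 0 ≤ γ) (hγ1 : γ < 1) {f : ℕ → ℝ} (hC : ∀ n, |f n| ≤ C) :
    |∑' n, γ ^ n * f n| ≤ (1 - γ)⁻¹ * C :=
  tsum_of_norm_bounded ((hasSum_geometric_of_lt_one hγ0 hγ1).mul_right C)
    (norm_discount_mul_le hγ0 hC)

theorem measurable_tsum_discount (hγ0 : 0 ≤ γ) (hγ1 : γ < 1) {f : ℕ → X → ℝ}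
    (hf : ∀ n, Measurable (f n)) (hC : ∀ n x, |f n x| ≤ C) :
    Measurable fun x => ∑' n, γ ^ n * f n x := by
  refine measurable_of_tendsto_metrizable
    (f := fun n x => ∑ i ∈ Finset.range n, γ ^ i * f i x)
    (fun n => Finset.measurable_fun_sum _ fun i _ => (hf i).const_mul _) ?_
  exact tendsto_pi_nhds.2 fun x =>
    (summable_discount hγ0 hγ1 fun n => hC n x).hasSum.tendsto_sum_nat

theorem integral_tsum_discount (μ : Measure X) [IsProbabilityMeasure μ] (hγ0 : 0 ≤ γ) (hγ1 : γ < 1)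
    {f : ℕ → X → ℝ} (hf : ∀ n, Measurable (f n)) (hC : ∀ n x, |f n x| ≤ C) :
    ∫ x, ∑' n, γ ^ n * f n x ∂μ = ∑' n, γ ^ n * ∫ x, f n x ∂μ := by
  have hint (n : ℕ) : Integrable (fun x => γ ^ n * f n x) μ :=
    (integrable_of_measurable_of_abs_le μ (hf n) (hC n)).const_mul _
  rw [← integral_tsum_of_summable_integral_norm hint]
  · simp_rw [integral_const_mul]
  · refine Summable.of_norm_bounded ((summable_geometric_of_lt_one hγ0 hγ1).mul_right C) fun n => ?_
    rw [Real.norm_of_nonneg (integral_nonneg fun x => norm_nonneg _)]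
    exact integral_le_of_forall_le μ (hint n).norm
      fun x => norm_discount_mul_le hγ0 (fun k => hC k x) n

end Bounded

/-! ### Values for bounded rewards -/

namespace MarkovGame

variable {N : ℕ} {S : Type*} [MeasurableSpace S] {A : Fin N → Type*} [∀ i, MeasurableSpace (A i)]
  {O : Fin N → Type*} (M : MarkovGame N S A O) {γ C : ℝ} (π : Policy S A)

/-- The transition operator of the state-action process under `π`: the expected value of `f` at the
next state-action pair. -/
noncomputable def transOp (f : S × (∀ i, A i) → ℝ) (x : S × (∀ i, A i)) : ℝ :=
  ∫ y, f y ∂(M.step π x)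

/-- The reward as a function of the state-action pair. -/
def reward (x : S × (∀ i, A i)) : ℝ := M.r x.1 x.2

/-- The action-value as a function of the state-action pair. -/
noncomputable def qFun (γ : ℝ) (x : S × (∀ i, A i)) : ℝ := M.Q γ π x.1 x.2

theorem measurable_transOp {f : S × (∀ i, A i) → ℝ} (hf : Measurable f) :
    Measurable (M.transOp π f) :=
  (hf.stronglyMeasurable.integral_kernel (κ := M.step π)).measurable

theorem transOp_eq {f : S × (∀ i, A i) → ℝ} (hf : Measurable f) (hC : ∀ x, |f x| ≤ C)
    (x : S × (∀ i, A i)) :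
    M.transOp π f x = ∫ s, ∫ a, f (s, a) ∂(π.kernel s) ∂(M.P x) := by
  rw [transOp, step_apply]
  exact Measure.integral_compProd (integrable_of_measurable_of_abs_le _ hf hC)

theorem measurable_transOp_iterate {f : S × (∀ i, A i) → ℝ} (hf : Measurable f) (n : ℕ) :
    Measurable ((M.transOp π)^[n] f) := by
  induction n with
  | zero => exact hf
  | succ n ih =>
    rw [Function.iterate_succ_apply']
    exact M.measurable_transOp π ih

theorem abs_transOp_iterate_le {f : S × (∀ i, A i) → ℝ} (hC : ∀ x, |f x| ≤ C) (n : ℕ) :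
    ∀ x, |(M.transOp π)^[n] f x| ≤ C := by
  induction n with
  | zero => exact hC
  | succ n ih =>
    intro x
    rw [Function.iterate_succ_apply']
    exact abs_integral_le_of_abs_le _ ih

/-- The expectation of `f` at time `n` is obtained by applying the transition operator `n` times. -/
theorem integral_pathLaw_coord (ρ : Measure (S × (∀ i, A i))) [IsProbabilityMeasure ρ] (n : ℕ)
    {f : S × (∀ i, A i) → ℝ} (hf : Measurable f) (hC : ∀ x, |f x| ≤ C) :
    ∫ ω, f (ω n) ∂(M.pathLaw π ρ) = ∫ x, (M.transOp π)^[n] f x ∂ρ := by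
  have hmap (k : ℕ) {h : S × (∀ i, A i) → ℝ} (hh : Measurable h) :
      ∫ ω, h (ω k) ∂(M.pathLaw π ρ) = ∫ x, h x ∂((M.pathLaw π ρ).map fun ω => ω k) :=
    (integral_map (measurable_pi_apply k).aemeasurable hh.aestronglyMeasurable).symm
  induction n generalizing f with
  | zero =>
    rw [hmap 0 hf]
    exact congrArg (fun m => ∫ x, f x ∂m) (map_zero_trajMeasure ρ (M.stepHist π))
  | succ n ih =>
    have hm := M.measurable_transOp π hf
    have := Measure.isProbabilityMeasure_map (μ := M.pathLaw π ρ)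
      (f := fun ω : ℕ → S × (∀ i, A i) => ω n) (measurable_pi_apply n).aemeasurable
    rw [Function.iterate_succ_apply, ← ih hm (M.abs_transOp_iterate_le π hC 1), hmap _ hf,
      hmap _ hm, map_succ_pathLaw, ← Measure.snd_compProd, Measure.snd,
      integral_map (by fun_prop) hf.aestronglyMeasurable]
    exact Measure.integral_compProd
      (integrable_of_measurable_of_abs_le _ (hf.comp measurable_snd) fun _ => hC _)

variable {M}

theorem measurable_ret (hγ0 : 0 ≤ γ) (hγ1 : γ < 1) (hr : ∀ s a, |M.r s a| ≤ C) :
    Measurable (M.ret γ) :=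
  measurable_tsum_discount (f := fun l (ω : ℕ → S × (∀ i, A i)) => M.r (ω l).1 (ω l).2) hγ0 hγ1
    (fun l => M.measurable_r.comp (measurable_pi_apply l)) fun _ _ => hr _ _

theorem hasExpectedRet_of_bounded (hγ0 : 0 ≤ γ) (hγ1 : γ < 1) (hr : ∀ s a, |M.r s a| ≤ C)
    (μ : Measure (ℕ → S × (∀ i, A i))) [IsFiniteMeasure μ] : M.HasExpectedRet γ μ :=
  ⟨ae_of_all _ fun _ => summable_discount hγ0 hγ1 fun _ => hr _ _,
    integrable_of_measurable_of_abs_le μ (measurable_ret hγ0 hγ1 hr)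
      fun _ => abs_tsum_discount_le hγ0 hγ1 fun _ => hr _ _⟩

theorem integral_ret_eq (hγ0 : 0 ≤ γ) (hγ1 : γ < 1) (hr : ∀ s a, |M.r s a| ≤ C)
    (ρ : Measure (S × (∀ i, A i))) [IsProbabilityMeasure ρ] :
    ∫ ω, M.ret γ ω ∂(M.pathLaw π ρ) =
      ∫ x, ∑' n, γ ^ n * (M.transOp π)^[n] M.reward x ∂ρ := by
  have hb (x : S × (∀ i, A i)) : |M.reward x| ≤ C := hr _ _
  have hm : Measurable M.reward := M.measurable_r
  rw [integral_tsum_discount ρ hγ0 hγ1 (M.measurable_transOp_iterate π hm)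
    (M.abs_transOp_iterate_le π hb)]
  simp_rw [← M.integral_pathLaw_coord π ρ _ hm hb]
  exact integral_tsum_discount (M.pathLaw π ρ) hγ0 hγ1
    (f := fun l (ω : ℕ → S × (∀ i, A i)) => M.reward (ω l))
    (fun l => hm.comp (measurable_pi_apply l)) fun _ _ => hb _

theorem qFun_eq_tsum (hγ0 : 0 ≤ γ) (hγ1 : γ < 1) (hr : ∀ s a, |M.r s a| ≤ C) :
    M.qFun π γ = fun x => ∑' n, γ ^ n * (M.transOp π)^[n] M.reward x := by
  funext x
  have hm := measurable_tsum_discount hγ0 hγ1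
    (M.measurable_transOp_iterate π (f := M.reward) M.measurable_r)
    (M.abs_transOp_iterate_le π (fun _ => hr _ _))
  exact (integral_ret_eq π hγ0 hγ1 hr _).trans
    (integral_dirac' _ _ hm.stronglyMeasurable)

theorem measurable_qFun (hγ0 : 0 ≤ γ) (hγ1 : γ < 1) (hr : ∀ s a, |M.r s a| ≤ C) :
    Measurable (M.qFun π γ) := by
  rw [qFun_eq_tsum π hγ0 hγ1 hr]
  exact measurable_tsum_discount hγ0 hγ1
    (M.measurable_transOp_iterate π (f := M.reward) M.measurable_r)
    (M.abs_transOp_iterate_le π (fun _ => hr _ _))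

theorem abs_qFun_le (hγ0 : 0 ≤ γ) (hγ1 : γ < 1) (hr : ∀ s a, |M.r s a| ≤ C)
    (x : S × (∀ i, A i)) : |M.qFun π γ x| ≤ (1 - γ)⁻¹ * C := by
  rw [qFun_eq_tsum π hγ0 hγ1 hr]
  exact abs_tsum_discount_le hγ0 hγ1 fun n => M.abs_transOp_iterate_le π (fun _ => hr _ _) n x

/-- The value is the action-value averaged over the first action. -/
theorem V_eq_integral (hγ0 : 0 ≤ γ) (hγ1 : γ < 1) (hr : ∀ s a, |M.r s a| ≤ C) (s : S) :
    M.V γ π s = ∫ a, M.qFun π γ (s, a) ∂(π.kernel s) := by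
  have := isProbabilityMeasure_initial π s
  have hm := measurable_qFun π hγ0 hγ1 hr
  rw [V, lawV, integral_ret_eq π hγ0 hγ1 hr, ← qFun_eq_tsum π hγ0 hγ1 hr,
    integral_map (by fun_prop) hm.aestronglyMeasurable]

/-- The Bellman equation of a policy. -/
theorem qFun_bellman (hγ0 : 0 ≤ γ) (hγ1 : γ < 1) (hr : ∀ s a, |M.r s a| ≤ C)
    (x : S × (∀ i, A i)) :
    M.qFun π γ x = M.reward x + γ * M.transOp π (M.qFun π γ) x := by
  have hb (x : S × (∀ i, A i)) : |M.reward x| ≤ C := hr _ _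
  have hm : Measurable M.reward := M.measurable_r
  have hs : Summable fun n => γ ^ n * (M.transOp π)^[n] M.reward x :=
    summable_discount hγ0 hγ1 fun n => M.abs_transOp_iterate_le π hb n x
  have h1 : M.transOp π (M.qFun π γ) x =
      ∑' n, γ ^ n * (M.transOp π)^[n + 1] M.reward x := by
    simp_rw [Function.iterate_succ_apply']
    rw [transOp, qFun_eq_tsum π hγ0 hγ1 hr]
    exact integral_tsum_discount _ hγ0 hγ1 (M.measurable_transOp_iterate π hm)
      (M.abs_transOp_iterate_le π hb)
  rw [h1, ← tsum_mul_left]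
  simp_rw [← mul_assoc, ← pow_succ']
  rw [qFun_eq_tsum π hγ0 hγ1 hr]
  refine hs.tsum_eq_zero_add.trans ?_
  simp

theorem transOp_sub {f h : S × (∀ i, A i) → ℝ} {B D : ℝ} (hf : Measurable f)
    (hB : ∀ x, |f x| ≤ B) (hh : Measurable h) (hD : ∀ x, |h x| ≤ D) (x : S × (∀ i, A i)) :
    M.transOp π (fun y => f y - h y) x = M.transOp π f x - M.transOp π h x :=
  integral_sub (integrable_of_measurable_of_abs_le _ hf hB)
    (integrable_of_measurable_of_abs_le _ hh hD)

/-- Comparison principle for the Bellman operator of `π`: a bounded subsolution lies below a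
bounded supersolution. -/
theorem le_of_bellman {u v : S × (∀ i, A i) → ℝ} {B D : ℝ} (hγ0 : 0 ≤ γ) (hγ1 : γ < 1)
    (hu : Measurable u) (hB : ∀ x, |u x| ≤ B) (hv : Measurable v) (hD : ∀ x, |v x| ≤ D)
    (hsub : ∀ x, u x ≤ M.reward x + γ * M.transOp π u x)
    (hsup : ∀ x, M.reward x + γ * M.transOp π v x ≤ v x) (x : S × (∀ i, A i)) : u x ≤ v x := by
  have habs (y : S × (∀ i, A i)) : |u y - v y| ≤ B + D :=
    (abs_sub _ _).trans (add_le_add (hB y) (hD y))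
  refine sub_nonpos.1 (nonpos_of_bound_mul (f := fun y => u y - v y) hγ0 hγ1
    (fun y => (le_abs_self _).trans (habs y)) (fun c _ hc y => ?_) x)
  have h1 : u y - v y ≤ γ * M.transOp π (fun y => u y - v y) y := by
    rw [transOp_sub π hu hB hv hD]
    linarith [hsub y, hsup y]
  refine h1.trans (mul_le_mul_of_nonneg_left ?_ hγ0)
  exact integral_le_of_forall_le _ (integrable_of_measurable_of_abs_le _ (hu.sub hv) habs) hc

end MarkovGame

/-! ### Optimal policies for finitely many joint actions -/

section ActionMax

variable {S 𝒜 : Type*}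

/-- The maximum of `q(s, ·)` over the actions. It is meant for finitely many actions: for an
unbounded `q(s, ·)` it is the junk value `0` of the supremum. -/
noncomputable def actionMax (q : S × 𝒜 → ℝ) (s : S) : ℝ := ⨆ a, q (s, a)

/-- The actions maximizing `q(s, ·)`. -/
def greedySet (q : S × 𝒜 → ℝ) (s : S) : Set 𝒜 := {a | ∀ b, q (s, b) ≤ q (s, a)}

theorem actionMax_le [Nonempty 𝒜] {q : S × 𝒜 → ℝ} {s : S} {c : ℝ} (h : ∀ a, q (s, a) ≤ c) :
    actionMax q s ≤ c :=
  ciSup_le h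

variable [Finite 𝒜]

theorem le_actionMax (q : S × 𝒜 → ℝ) (s : S) (a : 𝒜) : q (s, a) ≤ actionMax q s :=
  le_ciSup (f := fun a => q (s, a)) (Set.finite_range _).bddAbove a

theorem measurable_actionMax [MeasurableSpace S] [MeasurableSpace 𝒜] {q : S × 𝒜 → ℝ}
    (hq : Measurable q) : Measurable (actionMax q) :=
  Measurable.iSup fun _ => hq.comp measurable_prodMk_right

variable [Nonempty 𝒜]

theorem actionMax_eq_of_mem {q : S × 𝒜 → ℝ} {s : S} {a : 𝒜} (ha : a ∈ greedySet q s) :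
    q (s, a) = actionMax q s :=
  (le_actionMax q s a).antisymm (actionMax_le ha)

theorem abs_actionMax_sub_le {f h : S × 𝒜 → ℝ} {c : ℝ} (hc : ∀ x, |f x - h x| ≤ c) (s : S) :
    |actionMax f s - actionMax h s| ≤ c := by
  refine abs_sub_le_iff.2 ⟨?_, ?_⟩
  · refine sub_le_iff_le_add.2 (actionMax_le fun a => ?_)
    linarith [le_actionMax h s a, (abs_sub_le_iff.1 (hc (s, a))).1]
  · refine sub_le_iff_le_add.2 (actionMax_le fun a => ?_)
    linarith [le_actionMax f s a, (abs_sub_le_iff.1 (hc (s, a))).2]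

theorem abs_actionMax_le {f : S × 𝒜 → ℝ} {c : ℝ} (hc : ∀ x, |f x| ≤ c) (s : S) :
    |actionMax f s| ≤ c := by
  have h0 : actionMax (fun _ : S × 𝒜 => (0 : ℝ)) s = 0 := ciSup_const
  simpa [h0] using abs_actionMax_sub_le (f := f) (h := fun _ => 0) (c := c) (by simpa using hc) s

theorem greedySet_nonempty (q : S × 𝒜 → ℝ) (s : S) : (greedySet q s).Nonempty :=
  Finite.exists_max fun a => q (s, a)

end ActionMax

section GreedyPolicy

variable {N : ℕ} {S : Type*} [MeasurableSpace S] {A : Fin N → Type*} [∀ i, MeasurableSpace (A i)]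
  [Finite (∀ i, A i)] [Nonempty (∀ i, A i)] [MeasurableSingletonClass (∀ i, A i)]

/-- The policy that plays uniformly among the maximizers of `q(s, ·)`. -/
noncomputable def greedyPolicy (q : S × (∀ i, A i) → ℝ) (hq : Measurable q) : Policy S A where
  kernel :=
    { toFun := fun s => uniformOn (greedySet q s)
      measurable' := by
        have hm : Measurable (greedySet q) := by
          refine measurable_set_iff.2 fun a => ?_
          refine Measurable.forall fun b => measurableSet_setOfPred.1 ?_
          exact measurableSet_le
            (hq.comp measurable_prodMk_right) (hq.comp measurable_prodMk_right)
        exact (measurable_of_countable fun m : Set (∀ i, A i) => uniformOn m).comp hm }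
  markov := ⟨fun s => isProbabilityMeasure_uniformOn (Set.toFinite _) (greedySet_nonempty q s)⟩

theorem ae_mem_greedySet (q : S × (∀ i, A i) → ℝ) (hq : Measurable q) (s : S) :
    ∀ᵐ a ∂((greedyPolicy q hq).kernel s), a ∈ greedySet q s :=
  ae_cond_mem (Set.toFinite _).measurableSet

/-- If `q` is invariant, `K_g^s` maps the maximizers at `s` bijectively to those at `L_g[s]`, and so
the uniform distribution on the former to that on the latter. -/
theorem isInvariant_greedyPolicy {G : Type*} [Group G] {O : Fin N → Type*} (T : GameAction G S A O)
    (q : S × (∀ i, A i) → ℝ) (hq : Measurable q)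
    (h : ∀ g s a, q (T.L g s, T.K g s a) = q (s, a)) : (greedyPolicy q hq).IsInvariant T := by
  intro g s B _
  have hinj : Function.Injective (T.K g s) := (T.actionEquiv g s).injective
  have himg : greedySet q (T.L g s) = T.K g s '' greedySet q s := by
    ext a
    obtain ⟨a, rfl⟩ := (T.actionEquiv g s).surjective a
    change T.K g s a ∈ _ ↔ T.K g s a ∈ _
    rw [hinj.mem_set_image]
    refine ((T.actionEquiv g s).surjective.forall).trans (forall_congr' fun b => ?_)
    exact (by rw [h, h] : q (T.L g s, T.K g s b) ≤ q (T.L g s, T.K g s a) ↔ _)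
  change uniformOn (greedySet q (T.L g s)) _ = uniformOn (greedySet q s) B
  rw [himg, uniformOn, uniformOn, cond_apply (Set.toFinite _).measurableSet,
    cond_apply (Set.toFinite _).measurableSet, ← Set.image_inter hinj,
    Measure.count_injective_image hinj, Measure.count_injective_image hinj]

end GreedyPolicy

namespace MarkovGame

variable {N : ℕ} {S : Type*} [MeasurableSpace S] {A : Fin N → Type*} [∀ i, MeasurableSpace (A i)]
  {O : Fin N → Type*} {M : MarkovGame N S A O} {γ C : ℝ}

variable (M γ) in
/-- The Bellman optimality operator. -/
noncomputable def bellmanOp (q : S × (∀ i, A i) → ℝ) (x : S × (∀ i, A i)) : ℝ :=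
  M.reward x + γ * ∫ s, actionMax q s ∂(M.P x)

variable [Finite (∀ i, A i)]

theorem measurable_bellmanOp {q : S × (∀ i, A i) → ℝ} (hq : Measurable q) :
    Measurable (M.bellmanOp γ q) :=
  M.measurable_r.add
    (((measurable_actionMax hq).stronglyMeasurable.integral_kernel (κ := M.P)).measurable.const_mul
      γ)

variable [Nonempty (∀ i, A i)]

theorem abs_bellmanOp_sub_le (hγ0 : 0 ≤ γ) {f h : S × (∀ i, A i) → ℝ} {B D c : ℝ}
    (hf : Measurable f) (hB : ∀ x, |f x| ≤ B) (hh : Measurable h) (hD : ∀ x, |h x| ≤ D)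
    (hc : ∀ x, |f x - h x| ≤ c) (x : S × (∀ i, A i)) :
    |M.bellmanOp γ f x - M.bellmanOp γ h x| ≤ γ * c := by
  rw [bellmanOp, bellmanOp, add_sub_add_left_eq_sub, ← mul_sub, abs_mul, abs_of_nonneg hγ0,
    ← integral_sub
      (integrable_of_measurable_of_abs_le _ (measurable_actionMax hf) (abs_actionMax_le hB))
      (integrable_of_measurable_of_abs_le _ (measurable_actionMax hh) (abs_actionMax_le hD))]
  exact mul_le_mul_of_nonneg_left (abs_integral_le_of_abs_le _ (abs_actionMax_sub_le hc)) hγ0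

/-- Value iteration converges to a bounded measurable solution of the Bellman optimality
equation. -/
theorem exists_bellmanOp_fixedPoint (hγ0 : 0 ≤ γ) (hγ1 : γ < 1) (hr : ∀ s a, |M.r s a| ≤ C) :
    ∃ q : S × (∀ i, A i) → ℝ, Measurable q ∧ (∃ D, ∀ x, |q x| ≤ D) ∧ M.bellmanOp γ q = q := by
  have hγ : 0 < 1 - γ := sub_pos.2 hγ1
  -- The ball of radius `C / (1 - γ)` is stable under the operator.
  set D := C / (1 - γ) with hDdef
  have hD : C + γ * D = D := by rw [hDdef]; field_simp; ring
  set u : ℕ → S × (∀ i, A i) → ℝ := fun n => (M.bellmanOp γ)^[n] 0 with hu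
  have hus (n : ℕ) : u (n + 1) = M.bellmanOp γ (u n) := Function.iterate_succ_apply' _ _ _
  have hum (n : ℕ) : Measurable (u n) := by
    induction n with
    | zero => exact measurable_const
    | succ n ih => rw [hus]; exact measurable_bellmanOp ih
  have hub (n : ℕ) : ∀ x, |u n x| ≤ D := by
    induction n with
    | zero =>
      intro x
      have : 0 ≤ C := (abs_nonneg _).trans (hr x.1 x.2)
      simpa [hu, hDdef] using div_nonneg this hγ.le
    | succ n ih =>
      intro x
      rw [hus, bellmanOp, ← hD]
      refine (abs_add_le _ _).trans (add_le_add (hr _ _) ?_)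
      rw [abs_mul, abs_of_nonneg hγ0]
      exact mul_le_mul_of_nonneg_left (abs_integral_le_of_abs_le _ (abs_actionMax_le ih)) hγ0
  have hstep (n : ℕ) : ∀ x, |u n x - u (n + 1) x| ≤ D * γ ^ n := by
    induction n with
    | zero =>
      intro x
      simpa [hu] using hub 1 x
    | succ n ih =>
      intro x
      rw [hus, hus (n + 1), pow_succ', mul_left_comm]
      exact abs_bellmanOp_sub_le hγ0 (hum n) (hub n) (hum (n + 1)) (hub (n + 1)) ih x
  have hlim (x : S × (∀ i, A i)) : ∃ l, Filter.Tendsto (fun n => u n x) Filter.atTop (nhds l) :=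
    cauchySeq_tendsto_of_complete (cauchySeq_of_le_geometric γ D hγ1 fun n => hstep n x)
  choose q hq using hlim
  have hqm : Measurable q := measurable_of_tendsto_metrizable hum (tendsto_pi_nhds.2 hq)
  have hqb (x : S × (∀ i, A i)) : |q x| ≤ D := le_of_tendsto' (hq x).abs fun n => hub n x
  have hdist (n : ℕ) (x : S × (∀ i, A i)) : |u n x - q x| ≤ D * γ ^ n / (1 - γ) :=
    dist_le_of_le_geometric_of_tendsto γ D hγ1 (fun n => hstep n x) (hq x) n
  refine ⟨q, hqm, ⟨D, hqb⟩, funext fun x => ?_⟩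
  refine tendsto_nhds_unique (f := fun n => u (n + 1) x) (l := Filter.atTop) ?_
    ((Filter.tendsto_add_atTop_iff_nat 1).2 (hq x))
  refine tendsto_iff_dist_tendsto_zero.2 (squeeze_zero (fun _ => dist_nonneg)
    (g := fun n : ℕ => γ * (D * γ ^ n / (1 - γ))) (fun n => ?_) ?_)
  · rw [Real.dist_eq, hus]
    exact abs_bellmanOp_sub_le hγ0 (hum n) (hub n) hqm hqb (hdist n) x
  · simpa using
      (((tendsto_pow_atTop_nhds_zero_of_lt_one hγ0 hγ1).const_mul D).div_const (1 - γ)).const_mul γ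

/-- A bounded solution of the Bellman optimality equation dominates all action-values: it is a
supersolution of the Bellman equation of every policy. -/
theorem qFun_le_of_bellmanOp_eq (hγ0 : 0 ≤ γ) (hγ1 : γ < 1) (hr : ∀ s a, |M.r s a| ≤ C)
    {q : S × (∀ i, A i) → ℝ} {D : ℝ} (hq : Measurable q) (hD : ∀ x, |q x| ≤ D)
    (hfix : M.bellmanOp γ q = q) (π : Policy S A) (x : S × (∀ i, A i)) : M.qFun π γ x ≤ q x := by
  refine le_of_bellman π hγ0 hγ1 (measurable_qFun π hγ0 hγ1 hr) (abs_qFun_le π hγ0 hγ1 hr) hq hD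
    (fun y => (qFun_bellman π hγ0 hγ1 hr y).le) (fun y => ?_) x
  conv_rhs => rw [← hfix]
  rw [bellmanOp, M.transOp_eq π hq hD]
  refine add_le_add_right (mul_le_mul_of_nonneg_left ?_ hγ0) _
  refine integral_mono
    (integrable_of_measurable_of_abs_le _ ?_ fun s => abs_integral_le_of_abs_le _ fun a => hD (s, a))
    (integrable_of_measurable_of_abs_le _ (measurable_actionMax hq) (abs_actionMax_le hD))
    fun s => ?_
  · exact (hq.stronglyMeasurable.integral_kernel_prod_right' (κ := π.kernel)).measurable
  · exact integral_le_of_forall_le _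
      (integrable_of_measurable_of_abs_le _ (hq.comp measurable_prodMk_left) fun a => hD (s, a))
      fun a => le_actionMax q s a

variable [MeasurableSingletonClass (∀ i, A i)]

theorem integral_greedyPolicy {q : S × (∀ i, A i) → ℝ} (hq : Measurable q) (s : S) :
    ∫ a, q (s, a) ∂((greedyPolicy q hq).kernel s) = actionMax q s := by
  rw [integral_congr_ae ((ae_mem_greedySet q hq s).mono fun a ha => actionMax_eq_of_mem ha)]
  simp

/-- Averaging over maximizers is taking the maximum, so for the greedy policy the Bellman equation is
the optimality equation. -/
theorem qFun_greedyPolicy (hγ0 : 0 ≤ γ) (hγ1 : γ < 1) (hr : ∀ s a, |M.r s a| ≤ C)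
    {q : S × (∀ i, A i) → ℝ} {D : ℝ} (hq : Measurable q) (hD : ∀ x, |q x| ≤ D)
    (hfix : M.bellmanOp γ q = q) : M.qFun (greedyPolicy q hq) γ = q := by
  funext x
  refine (qFun_le_of_bellmanOp_eq hγ0 hγ1 hr hq hD hfix _ x).antisymm ?_
  refine le_of_bellman (greedyPolicy q hq) hγ0 hγ1 hq hD (measurable_qFun _ hγ0 hγ1 hr)
    (abs_qFun_le _ hγ0 hγ1 hr) (fun y => ?_) (fun y => (qFun_bellman _ hγ0 hγ1 hr y).ge) x
  rw [M.transOp_eq _ hq hD]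
  simp_rw [integral_greedyPolicy hq]
  exact (congrFun hfix y).ge

theorem isOptimal_greedyPolicy (hγ0 : 0 ≤ γ) (hγ1 : γ < 1) (hr : ∀ s a, |M.r s a| ≤ C)
    {q : S × (∀ i, A i) → ℝ} {D : ℝ} (hq : Measurable q) (hD : ∀ x, |q x| ≤ D)
    (hfix : M.bellmanOp γ q = q) : M.IsOptimal γ (greedyPolicy q hq) := by
  have hQ := qFun_greedyPolicy hγ0 hγ1 hr hq hD hfix
  refine ⟨fun s => ?_, fun s a => ?_⟩
  · have hE := hasExpectedRet_of_bounded hγ0 hγ1 hr (M.lawV (greedyPolicy q hq) s)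
    refine ⟨hE, le_antisymm (le_iSup₂_of_le _ hE le_rfl) (iSup₂_le fun π _ => ?_)⟩
    rw [EReal.coe_le_coe_iff, V_eq_integral _ hγ0 hγ1 hr, V_eq_integral _ hγ0 hγ1 hr, hQ,
      integral_greedyPolicy hq]
    refine integral_le_of_forall_le _ (integrable_of_measurable_of_abs_le _
      ((measurable_qFun π hγ0 hγ1 hr).comp measurable_prodMk_left)
      fun a => abs_qFun_le π hγ0 hγ1 hr (s, a)) fun a => ?_
    exact (qFun_le_of_bellmanOp_eq hγ0 hγ1 hr hq hD hfix π (s, a)).trans (le_actionMax q s a)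
  · have hE := hasExpectedRet_of_bounded hγ0 hγ1 hr (M.lawQ (greedyPolicy q hq) s a)
    refine ⟨hE, le_antisymm (le_iSup₂_of_le _ hE le_rfl) (iSup₂_le fun π _ => ?_)⟩
    rw [EReal.coe_le_coe_iff]
    exact (qFun_le_of_bellmanOp_eq hγ0 hγ1 hr hq hD hfix π (s, a)).trans
      (congrFun hQ (s, a)).ge

theorem IsSymmetric.exists_isInvariant_isOptimal {G : Type*} [Group G] {T : GameAction G S A O}
    (hM : M.IsSymmetric T) (hI : ∀ g s a x, T.I g s a x = x) (hγ0 : 0 ≤ γ) (hγ1 : γ < 1)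
    (hr : ∀ s a, |M.r s a| ≤ C) : ∃ π : Policy S A, π.IsInvariant T ∧ M.IsOptimal γ π := by
  obtain ⟨q, hq, ⟨D, hD⟩, hfix⟩ := exists_bellmanOp_fixedPoint (M := M) hγ0 hγ1 hr
  have hopt := isOptimal_greedyPolicy hγ0 hγ1 hr hq hD hfix
  have hQ := qFun_greedyPolicy hγ0 hγ1 hr hq hD hfix
  -- `q` is the optimal action-value, hence invariant.
  have hstar (s : S) (a : ∀ i, A i) : (q (s, a) : EReal) = M.Qstar γ s a := by
    rw [← (hopt.2 s a).2]
    exact congrArg _ (congrFun hQ (s, a)).symm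
  refine ⟨_, isInvariant_greedyPolicy T q hq fun g s a => ?_, hopt⟩
  rw [← EReal.coe_eq_coe_iff, hstar, hstar, ← hM.Qstar_eq hI γ g]

end MarkovGame

/-! ### Unique maximizers -/

namespace MarkovGame

variable {N : ℕ} {S : Type*} [MeasurableSpace S] {A : Fin N → Type*} [∀ i, MeasurableSpace (A i)]
  {O : Fin N → Type*} {M : MarkovGame N S A O} {γ C : ℝ}

/-- Policy improvement: the policy that plays `a` wherever this is at least as good as following
`π` once, and follows `π` elsewhere, is at least as good as `π`. Switching on this measurable set
of states, rather than at a single state, avoids assuming that points of `S` are measurable. -/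
theorem exists_improvement (hγ0 : 0 ≤ γ) (hγ1 : γ < 1) (hr : ∀ s a, |M.r s a| ≤ C)
    (π : Policy S A) (a : ∀ i, A i) :
    ∃ π' : Policy S A, ∀ s, M.V γ π s ≤ M.Q γ π s a → M.Q γ π s a ≤ M.V γ π' s := by
  classical
  set q := M.qFun π γ with hqdef
  have hq : Measurable q := measurable_qFun π hγ0 hγ1 hr
  have hD : ∀ x, |q x| ≤ (1 - γ)⁻¹ * C := abs_qFun_le π hγ0 hγ1 hr
  have hV : ∀ s, M.V γ π s = ∫ b, q (s, b) ∂(π.kernel s) := V_eq_integral π hγ0 hγ1 hr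
  have hint (π₁ : Policy S A) : Measurable fun s => ∫ b, q (s, b) ∂(π₁.kernel s) :=
    (hq.stronglyMeasurable.integral_kernel_prod_right' (κ := π₁.kernel)).measurable
  have hset : MeasurableSet {s | ∫ b, q (s, b) ∂(π.kernel s) ≤ q (s, a)} :=
    measurableSet_le (hint π) (hq.comp measurable_prodMk_right)
  let π' : Policy S A :=
    { kernel := Kernel.piecewise hset (Kernel.const S (Measure.dirac a)) π.kernel
      markov := inferInstance }
  have hpos (s : S) (hs : ∫ b, q (s, b) ∂(π.kernel s) ≤ q (s, a)) :
      ∫ b, q (s, b) ∂(π'.kernel s) = q (s, a) := by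
    have : π'.kernel s = Measure.dirac a :=
      (Kernel.piecewise_apply (hs := hset) s).trans (if_pos hs)
    rw [this]
    exact integral_dirac' _ _ (hq.comp measurable_prodMk_left).stronglyMeasurable
  have hstep (s : S) : ∫ b, q (s, b) ∂(π.kernel s) ≤ ∫ b, q (s, b) ∂(π'.kernel s) := by
    by_cases hs : ∫ b, q (s, b) ∂(π.kernel s) ≤ q (s, a)
    · rwa [hpos s hs]
    · have : π'.kernel s = π.kernel s := (Kernel.piecewise_apply (hs := hset) s).trans (if_neg hs)
      rw [this]
  have hle : ∀ x, q x ≤ M.qFun π' γ x := by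
    refine le_of_bellman π' hγ0 hγ1 hq hD (measurable_qFun π' hγ0 hγ1 hr)
      (abs_qFun_le π' hγ0 hγ1 hr) (fun x => ?_) (fun x => (qFun_bellman π' hγ0 hγ1 hr x).ge)
    refine (qFun_bellman π hγ0 hγ1 hr x).le.trans
      (add_le_add_right (mul_le_mul_of_nonneg_left ?_ hγ0) _)
    rw [← hqdef, M.transOp_eq π hq hD, M.transOp_eq π' hq hD]
    exact integral_mono
      (integrable_of_measurable_of_abs_le _ (hint π)
        fun s => abs_integral_le_of_abs_le _ fun b => hD (s, b))
      (integrable_of_measurable_of_abs_le _ (hint π')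
        fun s => abs_integral_le_of_abs_le _ fun b => hD (s, b)) hstep
  refine ⟨π', fun s hs => ?_⟩
  rw [hV] at hs
  rw [V_eq_integral π' hγ0 hγ1 hr]
  refine (hpos s hs).ge.trans (integral_mono ?_ ?_ fun b => hle (s, b))
  · exact integrable_of_measurable_of_abs_le _ (hq.comp measurable_prodMk_left) fun b => hD (s, b)
  · exact integrable_of_measurable_of_abs_le _
      ((measurable_qFun π' hγ0 hγ1 hr).comp measurable_prodMk_left)
      fun b => abs_qFun_le π' hγ0 hγ1 hr (s, b)

theorem IsOptimal.Q_le_V (hγ0 : 0 ≤ γ) (hγ1 : γ < 1) (hr : ∀ s a, |M.r s a| ≤ C)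
    {π : Policy S A} (hπ : M.IsOptimal γ π) (s : S) (a : ∀ i, A i) : M.Q γ π s a ≤ M.V γ π s := by
  by_contra! hlt
  obtain ⟨π', hπ'⟩ := exists_improvement hγ0 hγ1 hr π a
  have h1 : (M.V γ π' s : EReal) ≤ M.Vstar γ s :=
    le_iSup₂_of_le π' (hasExpectedRet_of_bounded hγ0 hγ1 hr _) le_rfl
  rw [← (hπ.1 s).2, EReal.coe_le_coe_iff] at h1
  linarith [hπ' s hlt.le]

/-- An optimal policy plays almost surely a joint action whose action-value is the value. -/
theorem IsOptimal.ae_Q_eq_V (hγ0 : 0 ≤ γ) (hγ1 : γ < 1) (hr : ∀ s a, |M.r s a| ≤ C)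
    {π : Policy S A} (hπ : M.IsOptimal γ π) (s : S) :
    ∀ᵐ a ∂(π.kernel s), M.Q γ π s a = M.V γ π s := by
  have hq : Integrable (fun a => M.qFun π γ (s, a)) (π.kernel s) :=
    integrable_of_measurable_of_abs_le _
      ((measurable_qFun π hγ0 hγ1 hr).comp measurable_prodMk_left)
      fun a => abs_qFun_le π hγ0 hγ1 hr (s, a)
  have h0 : ∫ a, M.V γ π s - M.qFun π γ (s, a) ∂(π.kernel s) = 0 := by
    rw [integral_sub (integrable_const _) hq, ← V_eq_integral π hγ0 hγ1 hr]
    simp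
  have h1 := (integral_eq_zero_iff_of_nonneg
    (fun a => sub_nonneg.2 (hπ.Q_le_V hγ0 hγ1 hr s a)) ((integrable_const _).sub hq)).1 h0
  exact h1.mono fun a ha => (sub_eq_zero.1 ha).symm

/-- If the optimal action-values have unique maximizers, then an optimal policy plays the maximizer
with certainty. The maximizer at `L_g[s]` is the image of that at `s`, so the policy is
invariant. -/
theorem IsSymmetric.isInvariant_of_isOptimal {G : Type*} [Group G] {T : GameAction G S A O}
    (hM : M.IsSymmetric T) (hI : ∀ g s a x, T.I g s a x = x) (hγ0 : 0 ≤ γ) (hγ1 : γ < 1)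
    (hr : ∀ s a, |M.r s a| ≤ C)
    (huniq : ∀ s a b, (∀ c, M.Qstar γ s c ≤ M.Qstar γ s a) →
      (∀ c, M.Qstar γ s c ≤ M.Qstar γ s b) → a = b)
    {π : Policy S A} (hπ : M.IsOptimal γ π) : π.IsInvariant T := by
  have hmax (s : S) (a : ∀ i, A i) (ha : M.Q γ π s a = M.V γ π s) (c : ∀ i, A i) :
      M.Qstar γ s c ≤ M.Qstar γ s a := by
    rw [← (hπ.2 s c).2, ← (hπ.2 s a).2, EReal.coe_le_coe_iff, ha]
    exact hπ.Q_le_V hγ0 hγ1 hr s c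
  intro g s B hB
  have hQ (a : ∀ i, A i) : M.Q γ π (T.L g s) (T.K g s a) = M.Q γ π s a := by
    rw [← EReal.coe_eq_coe_iff, (hπ.2 _ _).2, (hπ.2 _ _).2, hM.Qstar_eq hI γ g s a]
  have hV : M.V γ π (T.L g s) = M.V γ π s := by
    rw [← EReal.coe_eq_coe_iff, (hπ.1 _).2, (hπ.1 _).2, hM.Vstar_eq hI γ g s]
  have hdirac (t : S) (a : ∀ i, A i) (ha : M.Q γ π t a = M.V γ π t) :
      π.kernel t = Measure.dirac a := by
    have hae : ∀ᵐ b ∂(π.kernel t), b = a :=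
      (hπ.ae_Q_eq_V hγ0 hγ1 hr t).mono fun b hb => huniq t b a (hmax t b hb) (hmax t a ha)
    ext E hE
    rw [Measure.dirac_apply' _ hE]
    by_cases haE : a ∈ E
    · rw [Set.indicator_of_mem haE, Pi.one_apply]
      exact (prob_compl_eq_zero_iff hE).1 (mem_ae_iff.1 (hae.mono fun b hb => hb ▸ haE))
    · rw [Set.indicator_of_notMem haE, measure_eq_zero_iff_ae_notMem]
      exact hae.mono fun b hb => hb ▸ haE
  obtain ⟨a, ha⟩ := (hπ.ae_Q_eq_V hγ0 hγ1 hr s).exists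
  have hinj : Function.Injective (T.K g s) := (T.actionEquiv g s).injective
  have hKB : MeasurableSet (T.K g s '' B) := (T.actionEquiv g s).measurableSet_image.2 hB
  rw [hdirac s a ha, hdirac (T.L g s) (T.K g s a) (by rw [hQ, ha, hV]), Measure.dirac_apply' _ hB,
    Measure.dirac_apply' _ hKB]
  by_cases haB : a ∈ B
  · rw [Set.indicator_of_mem haB, Set.indicator_of_mem (hinj.mem_set_image.2 haB)]
    rfl
  · rw [Set.indicator_of_notMem haB, Set.indicator_of_notMem (mt hinj.mem_set_image.1 haB)]

end MarkovGame

theorem theorem1 {G : Type*} [Group G] {N : ℕ} {S : Type*} [MeasurableSpace S]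
    {A : Fin N → Type*} [∀ i, MeasurableSpace (A i)] [∀ i, Nonempty (A i)] {O : Fin N → Type*}
    (M : MarkovGame N S A O) (T : GameAction G S A O) (hM : M.IsSymmetric T)
    (hI : ∀ g s a x, T.I g s a x = x)
    (γ : ℝ) (hγ0 : 0 ≤ γ) (hγ1 : γ < 1) :
    -- (i) invariance of the optimal values
    ((∀ g s, M.Vstar γ s = M.Vstar γ (T.L g s)) ∧
      (∀ g s a, M.Qstar γ s a = M.Qstar γ (T.L g s) (T.K g s a))) ∧
    -- (ii) invariant optimal policies, for bounded rewards
    ((∃ C : ℝ, ∀ s a, |M.r s a| ≤ C) →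
      ((∀ i, Finite (A i)) → (∀ i, MeasurableSingletonClass (A i)) →
        ∃ π : Policy S A, π.IsInvariant T ∧ M.IsOptimal γ π) ∧
      ((∀ s a b, (∀ c, M.Qstar γ s c ≤ M.Qstar γ s a) →
          (∀ c, M.Qstar γ s c ≤ M.Qstar γ s b) → a = b) →
        ∀ π : Policy S A, M.IsOptimal γ π → π.IsInvariant T)) ∧
    -- (iii) values of invariant policies
    (∀ π : Policy S A, π.IsInvariant T →
      (∀ g s, (M.HasExpectedRet γ (M.lawV π s) ↔ M.HasExpectedRet γ (M.lawV π (T.L g s))) ∧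
        M.V γ π s = M.V γ π (T.L g s)) ∧
      (∀ g s a, (M.HasExpectedRet γ (M.lawQ π s a) ↔
          M.HasExpectedRet γ (M.lawQ π (T.L g s) (T.K g s a))) ∧
        M.Q γ π s a = M.Q γ π (T.L g s) (T.K g s a))) ∧
    -- (iv) gradients of invariant parameterized policies: probabilities of joint actions
    (∀ (d : ℕ) (π : EuclideanSpace ℝ (Fin d) → Policy S A), (∀ θ, (π θ).IsInvariant T) →
      ∀ g s a θ, DifferentiableAt ℝ (fun t => ((π t).kernel s).real {a}) θ →
        DifferentiableAt ℝ (fun t => ((π t).kernel (T.L g s)).real {T.K g s a}) θ ∧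
        gradient (fun t => ((π t).kernel s).real {a}) θ =
          gradient (fun t => ((π t).kernel (T.L g s)).real {T.K g s a}) θ) ∧
    -- (iv) gradients of invariant parameterized policies: densities
    (∀ (d : ℕ) (π : EuclideanSpace ℝ (Fin d) → Policy S A) (ν : Measure (∀ i, A i))
      (p : EuclideanSpace ℝ (Fin d) → S → (∀ i, A i) → ℝ),
      (∀ θ s, IsLikelihood ν ((π θ).kernel s) (p θ s)) →
      (∀ θ g s a, p θ (T.L g s) (T.K g s a) = p θ s a) →
      ∀ g s a θ, DifferentiableAt ℝ (fun t => p t s a) θ →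
        DifferentiableAt ℝ (fun t => p t (T.L g s) (T.K g s a)) θ ∧
        gradient (fun t => p t s a) θ =
          gradient (fun t => p t (T.L g s) (T.K g s a)) θ) := by
  refine ⟨⟨hM.Vstar_eq hI γ, hM.Qstar_eq hI γ⟩, ?_, ?_, ?_, ?_⟩
  · rintro ⟨C, hr⟩
    refine ⟨fun hfin hsing => ?_, fun huniq π hπ => ?_⟩
    · exact hM.exists_isInvariant_isOptimal hI hγ0 hγ1 hr
    · exact hM.isInvariant_of_isOptimal hI hγ0 hγ1 hr huniq hπ
  · intro π hπ
    refine ⟨fun g s => ⟨?_, ?_⟩, fun g s a => ⟨?_, ?_⟩⟩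
    · exact (hM.hasExpectedRet_lawV_iff hI γ (hπ.carries g) s).symm
    · exact (hM.V_eq hI γ (hπ.carries g) s).symm
    · exact (hM.hasExpectedRet_lawQ_iff hI γ (hπ.carries g) s a).symm
    · exact (hM.Q_eq hI γ (hπ.carries g) s a).symm
  · intro d π hπ g s a θ hd
    have h : (fun t => ((π t).kernel (T.L g s)).real {T.K g s a}) =
        fun t => ((π t).kernel s).real {a} := by
      funext t
      rw [Measure.real, Measure.real, ← Set.image_singleton, (hπ t).kernel_image]
    rw [h]
    exact ⟨hd, rfl⟩
  · intro d π ν p _ hp g s a θ hd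
    have h : (fun t => p t (T.L g s) (T.K g s a)) = fun t => p t s a :=
      funext fun t => hp t g s a
    rw [h]
    exact ⟨hd, rfl⟩
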